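/- Let $\mathcal C$ be a triangulated category with all small coproducts. An object $M$ is compact if the functor $\mathcal C(M,-)$ to abelian groups respects small coproducts. For classes $D,E$ of objects, $D\perp E$ means that every morphism from an object of $D$ to an object of $E$ is zero. Say that a set $P$ of objects compactly generates $\mathcal C$ if all its elements are compact and the smallest class of objects that contains $0$ and $\bigcup_{i\in\mathbb Z}P[i]$ and is closed under extensions and small coproducts is the class of all objects; an object $G$ is a compact generator if $\{G\}$ compactly generates $\mathcal C$. Say that $P$ is weakly negative if $P\perp P[i]$ for all $i>1$. For an object $G$ and integers $A,k>0$, let $\overline{\langle G\rangle}^{[-A,A]}$ be the class of all retracts of objects in the smallest class that contains $G[s]$ for $-A\le s\le A$ and is closed under extensions and small coproducts, and let $\overline{\langle G\rangle}^{[-A,A]}_k$ be the class of all retracts of objects in the $k$-fold product $S\star\cdots\star S$, where $S$ is the class of all small coproducts of objects $G[s]$ with $-A\le s\le A$, and $X\star Y$ is the class of all $Z$ that lie in a distinguished triangle $x\to Z\to y\to x[1]$ with $x\in X$, $y\in Y$. The category $\mathcal C$ is weakly approximable if there are a compact generator $G$, a $t$-structure $(\mathcal C^{\le 0},\mathcal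 C^{\ge 0})$ on $\mathcal C$ and an integer $A>0$ such that (i) $G[A]\in\mathcal C^{\le 0}$ and $\{G[-A]\}\perp\mathcal C^{\le 0}$; (ii) every $F\in\mathcal C^{\le 0}$ fits in a distinguished triangle $E\to F\to D\to E[1]$ with $D\in\mathcal C^{\le -1}=\mathcal C^{\le 0}[1]$ and $E\in\overline{\langle G\rangle}^{[-A,A]}$. It is approximable if $G$, the $t$-structure and $A$ can be chosen so that moreover $E$ in (ii) can always be taken in $\overline{\langle G\rangle}^{[-A,A]}_A$. Let $P$ be a finite weakly negative set of objects that compactly generates $\mathcal C$. (1) Then $\mathcal C$ is weakly approximable. (2) If moreover $P=\bigcup_{0\le i\le n}P_i$ for some $n\ge 0$, where $P_i\perp P_j[1]$ whenever $i\le j$, then $\mathcal C$ is approximable. In particular, if $\mathcal C$ has a compact generator $G$ such that $\{G\}\perp \{G[i]\}$ for all $i>0$, then $\mathcal C$ is approximable. -/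

import Mathlib

open CategoryTheory CategoryTheory.Limits CategoryTheory.Pretriangulated

universe v u

namespace SmashingTriangulated

section Coproducts

variable {C : Type u} [Category.{v} C]

/-- `M` is compact: the functor `C(M, -) : C ⥤ Ab` respects small coproducts. -/
def IsCompactObj [Preadditive C] (M : C) : Prop :=
  ∀ J : Type v,
    PreservesColimitsOfShape (Discrete J) (preadditiveCoyoneda.obj (Opposite.op M))

/-- The class of all small coproducts of objects of the class `P`. -/
def coproductsOf (P : ObjectProperty C) : ObjectProperty C :=
  fun X => ∃ J : Type v, P.colimitsOfShape (Discrete J) X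

end Coproducts

section Triangulated

variable {C : Type u} [Category.{v} C] [Preadditive C] [HasZeroObject C] [HasShift C ℤ]
  [∀ n : ℤ, (shiftFunctor C n).Additive] [Pretriangulated C]

/-- The big extension-closure of `P`: the smallest class of objects that contains `P` and `0`
and is closed under extensions and small coproducts. -/
inductive bigExtensionClosure (P : ObjectProperty C) : ObjectProperty C
  | of_mem {X : C} (hX : P X) : bigExtensionClosure P X
  | zero {X : C} (hX : IsZero X) : bigExtensionClosure P X
  | extension {T : Triangle C} (hT : T ∈ distTriang C)
      (h₁ : bigExtensionClosure P T.obj₁) (h₃ : bigExtensionClosure P T.obj₃) :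
      bigExtensionClosure P T.obj₂
  | coproduct {J : Type v} {X : J → C} {c : Cofan X} (hc : IsColimit c)
      (hX : ∀ j, bigExtensionClosure P (X j)) : bigExtensionClosure P c.pt

/-- The class of the objects `Y[i]` (up to isomorphism) for `Y ∈ P` and `i ∈ S`. -/
def shifts (P : Set C) (S : Set ℤ) : ObjectProperty C :=
  fun X => ∃ Y ∈ P, ∃ i ∈ S, Nonempty (X ≅ Y⟦i⟧)

/-- `P` compactly generates `C`: its elements are compact, and the big extension-closure of
the class of all shifts of its elements contains every object. -/
def CompactlyGenerates (P : Set C) : Prop :=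
  (∀ M ∈ P, IsCompactObj M) ∧ ∀ X : C, bigExtensionClosure (shifts P Set.univ) X

/-- Every morphism from an element of `D` to an element of `E[i]` is zero: `D ⊥ E[i]`. -/
def PerpShift (D E : Set C) (i : ℤ) : Prop :=
  ∀ X ∈ D, ∀ Y ∈ E, ∀ f : X ⟶ Y⟦i⟧, f = 0

/-- `P ⊥ P[i]` for all `i > 1`. -/
def IsWeaklyNegative (P : Set C) : Prop :=
  ∀ i : ℤ, 1 < i → PerpShift P P i

/-- The `n`-th power, with respect to the operation `⋆` of taking extensions, of the class of
small coproducts of elements of `P`. Here `extensionProductIter k` is the product of `k + 1`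
factors. -/
def coprodPow (P : ObjectProperty C) : ℕ → ObjectProperty C
  | 0 => IsZero
  | k + 1 => (coproductsOf P).extensionProductIter k

/-- The retracts of objects in the closure of `{G[i] | -A ≤ i ≤ A}` under small coproducts and
extensions. -/
def genInterval (G : C) (A : ℕ) : ObjectProperty C :=
  (bigExtensionClosure (shifts {G} (Set.Icc (-(A : ℤ)) A))).retractClosure

/-- The retracts of `k`-fold extensions of small coproducts of objects `G[i]`, `-A ≤ i ≤ A`. -/
def genIntervalPow (G : C) (A k : ℕ) : ObjectProperty C :=
  (coprodPow (shifts {G} (Set.Icc (-(A : ℤ)) A)) k).retractClosure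

/-- `G[A] ∈ C^{t ≤ 0}` and `G[-A] ⊥ C^{t ≤ 0}`. -/
def BoundedFor (G : C) (t : Triangulated.TStructure C) (A : ℕ) : Prop :=
  t.le 0 (G⟦(A : ℤ)⟧) ∧ ∀ Y : C, t.le 0 Y → ∀ f : G⟦-(A : ℤ)⟧ ⟶ Y, f = 0

/-- Every `F ∈ C^{t ≤ 0}` is the middle of a distinguished triangle `E ⟶ F ⟶ D ⟶ E[1]` with
`E` in the class `𝓔` and `D ∈ C^{t ≤ -1}`. -/
def ApproximatesBy (t : Triangulated.TStructure C) (𝓔 : ObjectProperty C) : Prop :=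
  ∀ F : C, t.le 0 F →
    ∃ (E D : C) (f : E ⟶ F) (g : F ⟶ D) (h : D ⟶ E⟦(1 : ℤ)⟧),
      Triangle.mk f g h ∈ distTriang C ∧ 𝓔 E ∧ t.le (-1) D

variable (C)

/-- Weak approximability in the sense of Neeman. -/
def IsWeaklyApproximable : Prop :=
  ∃ (G : C) (t : Triangulated.TStructure C) (A : ℕ), 0 < A ∧ CompactlyGenerates {G} ∧
    BoundedFor G t A ∧ ApproximatesBy t (genInterval G A)

/-- Approximability in the sense of Neeman. -/
def IsApproximable : Prop :=
  ∃ (G : C) (t : Triangulated.TStructure C) (A : ℕ), 0 < A ∧ CompactlyGenerates {G} ∧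
    BoundedFor G t A ∧ ApproximatesBy t (genIntervalPow G A A)

end Triangulated

end SmashingTriangulated

set_option linter.unusedSectionVars false

/-! Replace `P` by the direct sum `G` of its elements. `G` is again a compact generator, and `G ⊥
G[i]` for `i > 1`. Take the t-structure generated by `G`: `C^{≤ 0}` is the closure of the `G[i]`, `i
≥ 0`, under extensions and coproducts. Its truncations come from repeatedly killing all morphisms
from these `G[i]` and passing to the homotopy colimit (`exists_truncation`).

The key is a reordering principle (`IsBigClosed.extensionProduct`): if `A` and `B` are closed under
extensions and coproducts and `A ⊥ B[1]`, then extensions in the order `B ⋆ A` split, so `A ⋆ B` is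
closed as well. Apply it to the closure `K` of `G` and to `B = C^{≤ -1}`: since `B[1]` is generated
by the `G[i]` with `i ≥ 2`, weak negativity gives `K ⊥ B[1]`. As `K ⋆ B` contains all `G[i]`, `i ≥
0`, it contains `C^{≤ 0}`; this is weak approximability, with `E` built from unshifted copies of
`G`.

For (2), write `Coprod(P_i)` for the coproducts of elements of `P_i`. It is closed under extensions
because `P_i ⊥ P_i[1]`, and by the same principle so is `Coprod(P_0) ⋆ ⋯ ⋆ Coprod(P_n)`
(`isBigClosed_filtered`). This product contains `G`, hence `K`. Elements of `P` being retracts of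
`G`, each `E` is a retract of an `(n + 1)`-fold extension of coproducts of `G`. -/

namespace SmashingTriangulated

/-! ### Compact objects -/

section Compact

variable {C : Type u} [Category.{v} C] [Preadditive C]

/-- A subgroup of `Hom(M, ∐ X_j)`, with `M` compact, that contains all morphisms factoring
through some inclusion `X_j ⟶ ∐ X_j` contains every morphism. -/
lemma IsCompactObj.mem_of_forall_inj {M : C} (hM : IsCompactObj M) {J : Type v} {X : J → C}
    {c : Cofan X} (hc : IsColimit c) (S : AddSubgroup (M ⟶ c.pt))
    (hS : ∀ j (f : M ⟶ X j), f ≫ c.inj j ∈ S) (f : M ⟶ c.pt) : f ∈ S := by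
  have := hM J
  let F := preadditiveCoyoneda.obj (Opposite.op M)
  have hc' := isColimitOfPreserves F hc
  -- The projection modulo `S` vanishes on every summand, hence on the coproduct `F.obj c.pt`.
  let q : F.obj c.pt ⟶ AddCommGrpCat.of ((M ⟶ c.pt) ⧸ S) :=
    AddCommGrpCat.ofHom (QuotientAddGroup.mk' S)
  have hq : q = 0 := by
    refine hc'.hom_ext fun ⟨j⟩ => ?_
    ext g
    exact (QuotientAddGroup.eq_zero_iff (N := S) _).2 (hS j g)
  have := ConcreteCategory.congr_hom hq f
  exact (QuotientAddGroup.eq_zero_iff (N := S) f).1 this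

lemma IsCompactObj.of_isZero {M : C} (hM : IsZero M) : IsCompactObj M := by
  intro J
  refine ⟨fun {K} => ⟨fun {c} _ => ⟨?_⟩⟩⟩
  have hz (Y : C) : IsZero ((preadditiveCoyoneda.obj (Opposite.op M)).obj Y) := by
    rw [AddCommGrpCat.isZero_iff_subsingleton]
    exact ⟨fun f g => hM.eq_of_src f g⟩
  exact
    { desc := fun s => 0
      fac := fun s j => (hz _).eq_of_src _ _
      uniq := fun s m _ => (hz _).eq_of_src _ _ }

lemma IsCompactObj.of_iso {M N : C} (hM : IsCompactObj M) (e : M ≅ N) : IsCompactObj N := by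
  intro J
  have := hM J
  exact preservesColimitsOfShape_of_natIso (preadditiveCoyoneda.mapIso e.symm.op)

/-- A functor that is a direct sum of two functors preserving a colimit preserves it. -/
lemma preservesColimit_of_directSum {D : Type*} [Category* D] {A : Type*} [Category* A]
    [Preadditive A] {J : Type*} [Category* J] {K : J ⥤ D} {F F₁ F₂ : D ⥤ A} (i₁ : F ⟶ F₁)
    (i₂ : F ⟶ F₂) (p₁ : F₁ ⟶ F) (p₂ : F₂ ⟶ F)
    (tot : ∀ Y, i₁.app Y ≫ p₁.app Y + i₂.app Y ≫ p₂.app Y = 𝟙 (F.obj Y))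
    [PreservesColimit K F₁] [PreservesColimit K F₂] : PreservesColimit K F := by
  refine ⟨fun {c} hc => ⟨?_⟩⟩
  have h₁ := isColimitOfPreserves F₁ hc
  have h₂ := isColimitOfPreserves F₂ hc
  let s₁ (s : Cocone (K ⋙ F)) : Cocone (K ⋙ F₁) :=
    (Cocone.precompose (Functor.whiskerLeft K p₁)).obj s
  let s₂ (s : Cocone (K ⋙ F)) : Cocone (K ⋙ F₂) :=
    (Cocone.precompose (Functor.whiskerLeft K p₂)).obj s
  have tot' {Y : D} {Z : A} (f : F.obj Y ⟶ Z) :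
      i₁.app Y ≫ p₁.app Y ≫ f + i₂.app Y ≫ p₂.app Y ≫ f = f := by
    rw [← Category.assoc, ← Category.assoc, ← Preadditive.add_comp, tot, Category.id_comp]
  let ι (j : J) : K.obj j ⟶ c.pt := c.ι.app j
  let d₁ (s : Cocone (K ⋙ F)) : F₁.obj c.pt ⟶ s.pt := h₁.desc (s₁ s)
  let d₂ (s : Cocone (K ⋙ F)) : F₂.obj c.pt ⟶ s.pt := h₂.desc (s₂ s)
  have fac₁ (s : Cocone (K ⋙ F)) (j : J) :
      F₁.map (ι j) ≫ d₁ s = p₁.app (K.obj j) ≫ s.ι.app j := h₁.fac (s₁ s) j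
  have fac₂ (s : Cocone (K ⋙ F)) (j : J) :
      F₂.map (ι j) ≫ d₂ s = p₂.app (K.obj j) ≫ s.ι.app j := h₂.fac (s₂ s) j
  have fac (s : Cocone (K ⋙ F)) (j : J) :
      F.map (ι j) ≫ (i₁.app c.pt ≫ d₁ s + i₂.app c.pt ≫ d₂ s) = s.ι.app j := by
    rw [Preadditive.comp_add, ← Category.assoc, ← Category.assoc, i₁.naturality, i₂.naturality,
      Category.assoc, Category.assoc]
    refine (congrArg₂ (fun f g => i₁.app _ ≫ f + i₂.app _ ≫ g) (fac₁ s j) (fac₂ s j)).trans ?_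
    exact tot' (Y := K.obj j) (s.ι.app j)
  have uniq (s : Cocone (K ⋙ F)) (m : F.obj c.pt ⟶ s.pt)
      (hm : ∀ j, F.map (ι j) ≫ m = s.ι.app j) :
      m = i₁.app c.pt ≫ d₁ s + i₂.app c.pt ≫ d₂ s := by
    have e₁ : p₁.app c.pt ≫ m = d₁ s := h₁.hom_ext fun j => by
      refine Eq.trans ?_ (fac₁ s j).symm
      change F₁.map (ι j) ≫ p₁.app c.pt ≫ m = _
      rw [← hm j, ← Category.assoc, p₁.naturality, Category.assoc]
    have e₂ : p₂.app c.pt ≫ m = d₂ s := h₂.hom_ext fun j => by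
      refine Eq.trans ?_ (fac₂ s j).symm
      change F₂.map (ι j) ≫ p₂.app c.pt ≫ m = _
      rw [← hm j, ← Category.assoc, p₂.naturality, Category.assoc]
    rw [← e₁, ← e₂]
    exact (tot' m).symm
  exact
    { desc := fun s => i₁.app c.pt ≫ d₁ s + i₂.app c.pt ≫ d₂ s
      fac := fac
      uniq := uniq }

lemma IsCompactObj.biprod {M N : C} [HasBinaryBiproduct M N] (hM : IsCompactObj M)
    (hN : IsCompactObj N) : IsCompactObj (M ⊞ N) := by
  intro J
  have := hM J
  have := hN J
  refine ⟨fun {K} => preservesColimit_of_directSum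
    (preadditiveCoyoneda.map (biprod.inl : M ⟶ M ⊞ N).op)
    (preadditiveCoyoneda.map (biprod.inr : N ⟶ M ⊞ N).op)
    (preadditiveCoyoneda.map (biprod.fst : M ⊞ N ⟶ M).op)
    (preadditiveCoyoneda.map (biprod.snd : M ⊞ N ⟶ N).op) fun Y => ?_⟩
  have h (f : M ⊞ N ⟶ Y) : biprod.fst ≫ biprod.inl ≫ f + biprod.snd ≫ biprod.inr ≫ f = f := by
    rw [← Category.assoc, ← Category.assoc, ← Preadditive.add_comp, biprod.total,
      Category.id_comp]
  ext f
  exact h f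

end Compact

/-! ### Classes of coproducts -/

section Coproducts

variable {C : Type u} [Category.{v} C]

lemma coproductsOf.exists_cofan {P : ObjectProperty C} {X : C} (h : coproductsOf P X) :
    ∃ (J : Type v) (Y : J → C) (c : Cofan Y) (_ : IsColimit c), c.pt = X ∧ ∀ j, P (Y j) := by
  obtain ⟨J, ⟨h⟩⟩ := h
  let e : Discrete.functor (fun j => h.diag.obj ⟨j⟩) ≅ h.diag := Discrete.natIsoFunctor.symm
  exact ⟨J, fun j => h.diag.obj ⟨j⟩, (Cocone.precompose e.hom).obj h.cocone,
    (IsColimit.precomposeHomEquiv e _).symm h.isColimit, rfl, fun j => h.prop_diag_obj ⟨j⟩⟩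

lemma coproductsOf.of_cofan {P : ObjectProperty C} {J : Type v} {Y : J → C} {c : Cofan Y}
    (hc : IsColimit c) (hY : ∀ j, P (Y j)) : coproductsOf P c.pt :=
  ⟨J, ⟨{ diag := Discrete.functor Y, ι := c.ι, isColimit := hc, prop_diag_obj := fun j => hY j.as }⟩⟩

lemma coproductsOf.of_iso {P : ObjectProperty C} {X Y : C} (h : coproductsOf P X) (e : X ≅ Y) :
    coproductsOf P Y := by
  obtain ⟨J, ⟨h⟩⟩ := h
  exact ⟨J, ⟨h.ofIso e⟩⟩

lemma le_coproductsOf (P : ObjectProperty C) : P ≤ coproductsOf P := fun X hX =>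
  coproductsOf.of_cofan (J := PUnit) (Y := fun _ => X) (colimitCoconeOfUnique _).isColimit
    fun _ => hX

lemma coproductsOf.of_isZero [HasZeroMorphisms C] (P : ObjectProperty C) {X : C} (hX : IsZero X) :
    coproductsOf P X := by
  have hc : IsColimit (Cofan.mk (f := fun j : PEmpty.{v + 1} => j.elim) X fun j => j.elim) :=
    Cofan.IsColimit.mk _ (fun s => 0) (fun s j => j.elim) fun s m _ => hX.eq_of_src _ _
  exact coproductsOf.of_cofan hc fun j => j.elim

lemma coproductsOf.coproduct {P : ObjectProperty C} {J : Type v} {X : J → C} {c : Cofan X}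
    (hc : IsColimit c) (hX : ∀ j, coproductsOf P (X j)) : coproductsOf P c.pt := by
  choose K Y d hd hd' hY using fun j => (hX j).exists_cofan
  obtain rfl : X = fun j => (d j).pt := funext fun j => (hd' j).symm
  exact coproductsOf.of_cofan (J := Σ j, K j)
    (Cofan.isColimitTrans c hc (fun j k => (d j).inj k) hd) fun p => hY p.1 p.2

lemma coproductsOf.biprod {P : ObjectProperty C} [HasZeroMorphisms C] {X Y : C}
    [HasBinaryBiproduct X Y]
    (hX : coproductsOf P X)
    (hY : coproductsOf P Y) : coproductsOf P (X ⊞ Y) := by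
  let Z : ULift.{v} WalkingPair → C := fun j => pairFunction X Y j.down
  let c : Cofan Z := Cofan.mk (X ⊞ Y) fun
    | ⟨.left⟩ => (biprod.inl : X ⟶ X ⊞ Y)
    | ⟨.right⟩ => (biprod.inr : Y ⟶ X ⊞ Y)
  have hc : IsColimit c := Cofan.IsColimit.mk _
    (fun s => biprod.desc (s.inj ⟨.left⟩ : X ⟶ _) (s.inj ⟨.right⟩ : Y ⟶ _))
    (by
      rintro s ⟨_ | _⟩
      · exact biprod.inl_desc (X := X) (Y := Y) _ _
      · exact biprod.inr_desc (X := X) (Y := Y) _ _)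
    (fun s m hm => by
      apply biprod.hom_ext'
      · exact (hm ⟨.left⟩).trans (biprod.inl_desc (X := X) (Y := Y) _ _).symm
      · exact (hm ⟨.right⟩).trans (biprod.inr_desc (X := X) (Y := Y) _ _).symm)
  exact coproductsOf.coproduct hc (by rintro ⟨_ | _⟩ <;> assumption)

end Coproducts

section Shift

variable {C : Type u} [Category.{v} C] [HasShift C ℤ]

lemma shift_sigma_hom_ext {J : Type*} {X : J → C} [HasCoproduct X] {A : C}
    {f g : (∐ X)⟦(1 : ℤ)⟧ ⟶ A}
    (h : ∀ j, (Sigma.ι X j)⟦(1 : ℤ)⟧' ≫ f = (Sigma.ι X j)⟦(1 : ℤ)⟧' ≫ g) : f = g :=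
  Cofan.IsColimit.hom_ext
    (isColimitCofanMkObjOfIsColimit (shiftFunctor C (1 : ℤ)) _ _ (coproductIsCoproduct X)) _ _ h

lemma exists_shift_sigma_desc {J : Type*} {X : J → C} [HasCoproduct X] {A : C}
    (f : ∀ j, (X j)⟦(1 : ℤ)⟧ ⟶ A) :
    ∃ g : (∐ X)⟦(1 : ℤ)⟧ ⟶ A, ∀ j, (Sigma.ι X j)⟦(1 : ℤ)⟧' ≫ g = f j := by
  let hc := isColimitCofanMkObjOfIsColimit (shiftFunctor C (1 : ℤ)) _ _ (coproductIsCoproduct X)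
  exact ⟨Cofan.IsColimit.desc hc f, fun j => Cofan.IsColimit.fac hc f j⟩

end Shift

/-! ### Coproducts of triangles, closed classes and orthogonality -/

section Pretriangulated

variable {C : Type u} [Category.{v} C] [Preadditive C] [HasZeroObject C] [HasShift C ℤ]
  [∀ n : ℤ, (shiftFunctor C n).Additive] [Pretriangulated C]

lemma exists_comp_of_distinguished₂ {X Y Z A : C} {f : X ⟶ Y} {g : Y ⟶ Z} {h : Z ⟶ X⟦(1 : ℤ)⟧}
    (hT : Triangle.mk f g h ∈ distTriang C) (k : Y ⟶ A) (hk : f ≫ k = 0) :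
    ∃ l : Z ⟶ A, k = g ≫ l :=
  Triangle.yoneda_exact₂ _ hT k hk

lemma exists_comp_of_distinguished₃ {X Y Z A : C} {f : X ⟶ Y} {g : Y ⟶ Z} {h : Z ⟶ X⟦(1 : ℤ)⟧}
    (hT : Triangle.mk f g h ∈ distTriang C) (k : Z ⟶ A) (hk : g ≫ k = 0) :
    ∃ l : X⟦(1 : ℤ)⟧ ⟶ A, k = h ≫ l :=
  Triangle.yoneda_exact₃ _ hT k hk

lemma exists_comp_of_distinguished_shift {X Y Z A : C} {f : X ⟶ Y} {g : Y ⟶ Z}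
    {h : Z ⟶ X⟦(1 : ℤ)⟧} (hT : Triangle.mk f g h ∈ distTriang C) (k : X⟦(1 : ℤ)⟧ ⟶ A)
    (hk : h ≫ k = 0) : ∃ l : Y⟦(1 : ℤ)⟧ ⟶ A, k = f⟦(1 : ℤ)⟧' ≫ l := by
  obtain ⟨l, hl⟩ := Triangle.yoneda_exact₃ _ (rot_of_distTriang _ hT) k hk
  exact ⟨-l, hl.trans ((Preadditive.neg_comp _ _).trans (Preadditive.comp_neg _ _).symm)⟩

lemma comp_zero_of_distinguished₁₂ {X Y Z : C} {f : X ⟶ Y} {g : Y ⟶ Z} {h : Z ⟶ X⟦(1 : ℤ)⟧}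
    (hT : Triangle.mk f g h ∈ distTriang C) : f ≫ g = 0 :=
  comp_distTriang_mor_zero₁₂ _ hT

lemma comp_zero_of_distinguished₃₁ {X Y Z : C} {f : X ⟶ Y} {g : Y ⟶ Z} {h : Z ⟶ X⟦(1 : ℤ)⟧}
    (hT : Triangle.mk f g h ∈ distTriang C) : h ≫ f⟦(1 : ℤ)⟧' = 0 :=
  comp_distTriang_mor_zero₃₁ _ hT

lemma distinguished_of_iso {X Y Y' Z Z' : C} {f : X ⟶ Y} {g : Y ⟶ Z}
    {h : Z ⟶ X⟦(1 : ℤ)⟧} {f' : X ⟶ Y'} {g' : Y' ⟶ Z'} {h' : Z' ⟶ X⟦(1 : ℤ)⟧}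
    (hT : Triangle.mk f g h ∈ distTriang C) (e₂ : Y' ≅ Y) (e₃ : Z' ≅ Z)
    (comm₁ : f' ≫ e₂.hom = f) (comm₂ : g' ≫ e₃.hom = e₂.hom ≫ g) (comm₃ : h' = e₃.hom ≫ h) :
    Triangle.mk f' g' h' ∈ distTriang C :=
  isomorphic_distinguished _ hT _ (Triangle.isoMk _ _ (Iso.refl X) e₂ e₃
    (comm₁.trans (Category.id_comp f).symm) comm₂
    ((congrArg (h' ≫ ·) ((shiftFunctor C (1 : ℤ)).map_id X)).trans ((Category.comp_id h').trans comm₃)))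

/-- A coproduct of distinguished triangles is distinguished. -/
lemma exists_sigma_distinguished {J : Type*} {X Y Z : J → C} {f : ∀ j, X j ⟶ Y j}
    {g : ∀ j, Y j ⟶ Z j} {h : ∀ j, Z j ⟶ (X j)⟦(1 : ℤ)⟧}
    (hT : ∀ j, Triangle.mk (f j) (g j) (h j) ∈ distTriang C)
    [HasCoproduct X] [HasCoproduct Y] [HasCoproduct Z] :
    ∃ w, Triangle.mk (Limits.Sigma.map f) (Limits.Sigma.map g) w ∈ distTriang C := by
  obtain ⟨W, f₂, f₃, hT'⟩ := distinguished_cocone_triangle (Limits.Sigma.map f)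
  have hψ (j : J) : ∃ ψ : Z j ⟶ W, g j ≫ ψ = Sigma.ι Y j ≫ f₂ ∧
      h j ≫ (Sigma.ι X j)⟦(1 : ℤ)⟧' = ψ ≫ f₃ :=
    complete_distinguished_triangle_morphism _ _ (hT j) hT' (Sigma.ι X j) (Sigma.ι Y j)
      (Sigma.ι_map f j).symm
  choose ψ hψ₂ hψ₃ using hψ
  let φ : ∐ Z ⟶ W := Sigma.desc ψ
  have hφ (j : J) : Sigma.ι Z j ≫ φ = ψ j := Sigma.ι_desc _ _
  have hφ₂ : Limits.Sigma.map g ≫ φ = f₂ := by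
    refine Sigma.hom_ext _ _ fun j => ?_
    rw [Sigma.ι_map_assoc, hφ, hψ₂]
  -- A five lemma by hand: `Hom(-, A)` turns the given triangles into exact sequences, whose product
  -- is exact, although the coproduct triangle is not yet known to be distinguished.
  have : IsIso φ := by
    refine isIso_of_coyoneda_map_bijective _ fun A => ⟨?_, ?_⟩
    · suffices ∀ k : W ⟶ A, φ ≫ k = 0 → k = 0 by
        intro a₁ a₂ ha
        exact sub_eq_zero.1 (this _ (by rw [Preadditive.comp_sub]; exact sub_eq_zero.2 ha))
      intro k hk
      obtain ⟨l, rfl⟩ := exists_comp_of_distinguished₃ hT' k (by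
        rw [← hφ₂, Category.assoc, hk, comp_zero])
      have hl (j : J) : ∃ α, (Sigma.ι X j)⟦(1 : ℤ)⟧' ≫ l = (f j)⟦(1 : ℤ)⟧' ≫ α := by
        refine exists_comp_of_distinguished_shift (hT j) _ ?_
        rw [← Category.assoc, hψ₃, Category.assoc, ← hφ, Category.assoc, hk, comp_zero]
      choose α hα using hl
      obtain ⟨b, hb⟩ := exists_shift_sigma_desc α
      have : l = (Limits.Sigma.map f)⟦(1 : ℤ)⟧' ≫ b := by
        refine shift_sigma_hom_ext fun j => ?_
        rw [hα, ← Category.assoc, ← Functor.map_comp, Sigma.ι_map, Functor.map_comp,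
          Category.assoc, hb]
      rw [this, ← Category.assoc, comp_zero_of_distinguished₃₁ hT', zero_comp]
    · intro a
      obtain ⟨b', hb'⟩ := exists_comp_of_distinguished₂ hT' (Limits.Sigma.map g ≫ a) (by
        refine Sigma.hom_ext _ _ fun j => ?_
        rw [Sigma.ι_map_assoc, Sigma.ι_map_assoc, ← Category.assoc,
          comp_zero_of_distinguished₁₂ (hT j), zero_comp, comp_zero])
      have hb (j : J) : ∃ β, Sigma.ι Z j ≫ (a - φ ≫ b') = h j ≫ β := by
        refine exists_comp_of_distinguished₃ (hT j) _ ?_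
        have h₁ : Sigma.ι Y j ≫ Limits.Sigma.map g ≫ a = Sigma.ι Y j ≫ f₂ ≫ b' :=
          congrArg (Sigma.ι Y j ≫ ·) hb'
        rw [Sigma.ι_map_assoc] at h₁
        rw [Preadditive.comp_sub, Preadditive.comp_sub, h₁, ← hφ₂, Category.assoc,
          Sigma.ι_map_assoc, sub_self]
      choose β hβ using hb
      obtain ⟨b, hb⟩ := exists_shift_sigma_desc β
      refine ⟨b' + f₃ ≫ b, Sigma.hom_ext _ _ fun j => ?_⟩
      have h₂ := hβ j
      rw [Preadditive.comp_sub, sub_eq_iff_eq_add] at h₂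
      dsimp
      rw [h₂, Preadditive.comp_add, Preadditive.comp_add, reassoc_of% hφ, ← hb, ← Category.assoc,
        ← Category.assoc, ← Category.assoc, hψ₃, hφ, Category.assoc, add_comm]
  exact ⟨φ ≫ f₃, distinguished_of_iso hT' (Iso.refl _) (asIso φ) (Category.comp_id _)
    (hφ₂.trans (Category.id_comp _).symm) rfl⟩

/-- The class `P` contains the zero objects and is closed under extensions and small
coproducts. -/
structure IsBigClosed (P : ObjectProperty C) : Prop where
  zero {X : C} (hX : IsZero X) : P X
  extension {T : Triangle C} (hT : T ∈ distTriang C) (h₁ : P T.obj₁) (h₃ : P T.obj₃) : P T.obj₂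
  coproduct {J : Type v} {X : J → C} {c : Cofan X} (hc : IsColimit c) (hX : ∀ j, P (X j)) :
    P c.pt

lemma isBigClosed_bigExtensionClosure (P : ObjectProperty C) :
    IsBigClosed (bigExtensionClosure P) :=
  ⟨.zero, .extension, .coproduct⟩

lemma IsBigClosed.closure_le {P Q : ObjectProperty C} (hQ : IsBigClosed Q) (h : P ≤ Q) :
    bigExtensionClosure P ≤ Q := by
  intro X hX
  induction hX with
  | of_mem hX => exact h _ hX
  | zero hX => exact hQ.zero hX
  | extension hT _ _ h₁ h₃ => exact hQ.extension hT h₁ h₃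
  | coproduct hc _ h => exact hQ.coproduct hc h

lemma bigExtensionClosure_monotone {P Q : ObjectProperty C} (h : P ≤ Q) :
    bigExtensionClosure P ≤ bigExtensionClosure Q :=
  (isBigClosed_bigExtensionClosure Q).closure_le fun X hX => .of_mem (h X hX)

/-- `Y` is a coproduct of the single object `X`, with the isomorphism as coprojection. -/
lemma IsBigClosed.of_iso {P : ObjectProperty C} (hP : IsBigClosed P) {X Y : C} (e : X ≅ Y)
    (hX : P X) : P Y :=
  hP.coproduct (J := PUnit) (X := fun _ => X)
    (c := (Cofan.mk Y fun _ => e.hom))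
    (Cofan.IsColimit.mk _ (fun s => e.inv ≫ s.inj ⟨⟩) (fun _ _ => e.hom_inv_id_assoc _)
      fun _ _ hm => e.eq_inv_comp.2 (hm ⟨⟩)) fun _ => hX

lemma IsBigClosed.biprod {P : ObjectProperty C} (hP : IsBigClosed P) {X Y : C}
    (hX : P X) (hY : P Y) : P (X ⊞ Y) :=
  hP.extension (binaryBiproductTriangle_distinguished X Y) hX hY

lemma IsBigClosed.inverseImage_shift {P : ObjectProperty C} (hP : IsBigClosed P) (n : ℤ) :
    IsBigClosed (fun X => P (X⟦n⟧)) where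
  zero hX := hP.zero ((shiftFunctor C n).map_isZero hX)
  extension hT h₁ h₃ := hP.extension (Triangle.shift_distinguished _ hT n) h₁ h₃
  coproduct {_ _ c} hc hX := hP.coproduct
    (isColimitCofanMkObjOfIsColimit (shiftFunctor C n) _ c.inj
      (IsColimit.ofIsoColimit hc (Cofan.ext (Iso.refl _) fun _ => by simp))) hX

lemma isBigClosed_leftOrthogonal (Y : C) :
    IsBigClosed (fun X : C => ∀ f : X ⟶ Y, f = 0) where
  zero hX f := hX.eq_of_src _ _
  extension hT h₁ h₃ f := by
    obtain ⟨g, rfl⟩ := Triangle.yoneda_exact₂ _ hT f (h₁ _)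
    rw [h₃ g, comp_zero]
  coproduct hc hX f := Cofan.IsColimit.hom_ext hc _ _ fun j => by
    rw [hX j (_ ≫ f), comp_zero]

lemma isBigClosed_rightOrthogonal {M : C} (hM : IsCompactObj M) :
    IsBigClosed (fun Y : C => ∀ f : M ⟶ Y, f = 0) where
  zero hY f := hY.eq_of_tgt _ _
  extension hT h₁ h₃ f := by
    obtain ⟨g, rfl⟩ := Triangle.coyoneda_exact₂ _ hT f (h₃ _)
    rw [h₁ g, zero_comp]
  coproduct hc hX f := hM.mem_of_forall_inj hc ⊥ (fun j g => by
    rw [hX j g, zero_comp]; rfl) f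

/-- Dévissage in both variables: reduce the source to `P` first; it is then compact, so the
vanishing also passes through coproducts in the target. -/
lemma eq_zero_of_mem_closure {P Q : ObjectProperty C}
    (hP : ∀ X, P X → IsCompactObj X) (h : ∀ X Y, P X → Q Y → ∀ f : X ⟶ Y, f = 0)
    {X Y : C} (hX : bigExtensionClosure P X) (hY : bigExtensionClosure Q Y) (f : X ⟶ Y) :
    f = 0 :=
  (isBigClosed_leftOrthogonal Y).closure_le (fun X hX =>
    (isBigClosed_rightOrthogonal (hP X hX)).closure_le (fun Y hY => h X Y hX hY) Y hY) X hX f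

lemma IsBigClosed.extensionProduct_le {P : ObjectProperty C} (hP : IsBigClosed P) :
    ObjectProperty.extensionProduct P P ≤ P := by
  rintro X ⟨Y, Z, f, g, h, hT, hY, hZ⟩
  exact hP.extension hT hY hZ

end Pretriangulated

/-! ### Reordering extensions -/

section Triangulated

variable {C : Type u} [Category.{v} C] [Preadditive C] [HasZeroObject C] [HasShift C ℤ]
  [∀ n : ℤ, (shiftFunctor C n).Additive] [Pretriangulated C] [IsTriangulated C]

open ObjectProperty

/-- If `A` and `B` are closed under extensions and coproducts and there are no nonzero morphisms
from `A` to `B[1]`, then the class of extensions of `B` by `A` is closed in the same sense. -/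
lemma IsBigClosed.extensionProduct [HasCoproducts.{v} C] {A B : ObjectProperty C}
    (hA : IsBigClosed A) (hB : IsBigClosed B)
    (h : ∀ X Y, A X → B Y → ∀ f : X ⟶ Y⟦(1 : ℤ)⟧, f = 0) :
    IsBigClosed (extensionProduct A B) := by
  have : A.ContainsZero := ⟨⟨_, isZero_zero C, hA.zero (isZero_zero C)⟩⟩
  -- The connecting morphism is zero, so the triangle splits and its outer terms can be exchanged.
  have hswap : ObjectProperty.extensionProduct B A ≤ ObjectProperty.extensionProduct A B := by
    rintro X ⟨Y, Z, f, g, w, hT, hY, hZ⟩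
    obtain ⟨e, -, -⟩ := exists_iso_binaryBiproduct_of_distTriang _ hT (h _ _ hZ hY w)
    exact prop_of_iso _ (biprod.braiding Z Y ≪≫ e.symm)
      ⟨_, _, _, _, _, binaryBiproductTriangle_distinguished Z Y, hZ, hY⟩
  -- `A ⋆ (B ⋆ A) ⋆ B ≤ (A ⋆ A) ⋆ (B ⋆ B) ≤ A ⋆ B`.
  have hmul : ObjectProperty.extensionProduct (ObjectProperty.extensionProduct A B)
      (ObjectProperty.extensionProduct A B) ≤ ObjectProperty.extensionProduct A B := by
    rw [extensionProduct_assoc, ← extensionProduct_assoc B A B]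
    refine (monotone_extensionProduct_right _ (monotone_extensionProduct_left _ hswap)).trans ?_
    rw [extensionProduct_assoc, ← extensionProduct_assoc A A]
    exact (monotone_extensionProduct_left _ hA.extensionProduct_le).trans
      (monotone_extensionProduct_right _ hB.extensionProduct_le)
  refine ⟨fun hX => le_extensionProduct_right A _ (hB.zero hX),
    fun {T} hT h₁ h₃ => hmul _ ⟨_, _, _, _, _, hT, h₁, h₃⟩, fun {J X c} hc hX => ?_⟩
  choose Y Z f g w hT hY hZ using hX
  obtain ⟨w', hT'⟩ := exists_sigma_distinguished hT
  refine prop_of_iso (ObjectProperty.extensionProduct A B)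
    ((coproductIsCoproduct X).coconePointUniqueUpToIso hc)
    ⟨_, _, _, _, _, hT', hA.coproduct (coproductIsCoproduct Y) hY,
      hB.coproduct (coproductIsCoproduct Z) hZ⟩

end Triangulated

/-! ### Sequences and homotopy colimits -/

section Telescope

variable {C : Type u} [Category.{v} C] [Preadditive C]

/-- If `M` is compact and `s` is the shift endomorphism of the coproduct of a sequence, then
`𝟙 - s` induces an injection on morphisms from `M`. -/
lemma IsCompactObj.eq_zero_of_comp_shift_eq {M : C} (hM : IsCompactObj M) {X : ℕ → C}
    (x : ∀ n, X n ⟶ X (n + 1)) {c : Cofan fun n : ULift.{v} ℕ => X n.down} (hc : IsColimit c)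
    (s : c.pt ⟶ c.pt) (hs : ∀ n, c.inj ⟨n⟩ ≫ s = x n ≫ c.inj ⟨n + 1⟩)
    (f : M ⟶ c.pt) (hf : f ≫ s = f) : f = 0 := by
  classical
  -- Projection to the first `N` summands. As `s` raises the index by one, `f = f ≫ s` forces `f ≫ e
  -- N = 0` for all `N` by induction, while compactness gives `f ≫ e N = f` for large `N`.
  let e (N : ℕ) : c.pt ⟶ c.pt :=
    Cofan.IsColimit.desc hc fun n => if n.down < N then c.inj n else 0
  have he (N n : ℕ) : c.inj ⟨n⟩ ≫ e N = if n < N then c.inj ⟨n⟩ else 0 :=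
    Cofan.IsColimit.fac hc _ _
  have he₀ : e 0 = 0 := Cofan.IsColimit.hom_ext hc _ _ fun ⟨n⟩ => by
    rw [he, if_neg (by omega), comp_zero]
  have hse (N : ℕ) : s ≫ e (N + 1) = e N ≫ s := Cofan.IsColimit.hom_ext hc _ _ fun ⟨n⟩ => by
    rw [reassoc_of% hs, reassoc_of% he, he]
    by_cases h : n < N
    · rw [if_pos (by omega), if_pos h, hs]
    · rw [if_neg (by omega), if_neg h, comp_zero, zero_comp]
  have hfe (N : ℕ) : f ≫ e N = 0 := by
    induction N with
    | zero => rw [he₀, comp_zero]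
    | succ N ih => rw [← hf, Category.assoc, hse, reassoc_of% ih, zero_comp]
  let S : AddSubgroup (M ⟶ c.pt) :=
    { carrier := {g | ∃ N, ∀ N', N ≤ N' → g ≫ e N' = g}
      zero_mem' := ⟨0, fun _ _ => zero_comp⟩
      add_mem' := by
        rintro a b ⟨N, hN⟩ ⟨N', hN'⟩
        refine ⟨max N N', fun K hK => ?_⟩
        rw [Preadditive.add_comp, hN _ (by omega), hN' _ (by omega)]
      neg_mem' := by
        rintro a ⟨N, hN⟩
        refine ⟨N, fun K hK => ?_⟩
        rw [Preadditive.neg_comp, hN _ hK] }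
  obtain ⟨N, hN⟩ : f ∈ S := hM.mem_of_forall_inj hc S (fun ⟨n⟩ g => ⟨n + 1, fun K hK => by
    rw [Category.assoc, he, if_pos (by omega)]⟩) f
  rw [← hN N le_rfl, hfe]

end Telescope

section Sequences

variable {C : Type u} [Category.{v} C] [HasCoproducts.{v} C]

/-- The coproduct of a sequence of objects. -/
noncomputable abbrev seqSum (X : ℕ → C) : C := ∐ fun n : ULift.{v} ℕ => X n.down

/-- The inclusion of a term into the coproduct of a sequence. -/
noncomputable abbrev seqι (X : ℕ → C) (n : ℕ) : X n ⟶ seqSum X :=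
  Sigma.ι (fun n : ULift.{v} ℕ => X n.down) ⟨n⟩

lemma seqSum_hom_ext {X : ℕ → C} {Y : C} {f g : seqSum X ⟶ Y}
    (h : ∀ n, seqι X n ≫ f = seqι X n ≫ g) : f = g :=
  Sigma.hom_ext _ _ fun ⟨n⟩ => h n

/-- The morphism out of the coproduct of a sequence given by its components. -/
noncomputable def seqDesc {X : ℕ → C} {Y : C} (f : ∀ n, X n ⟶ Y) : seqSum X ⟶ Y :=
  Sigma.desc fun n => f n.down

lemma seqι_seqDesc {X : ℕ → C} {Y : C} (f : ∀ n, X n ⟶ Y) (n : ℕ) :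
    seqι X n ≫ seqDesc f = f n :=
  Sigma.ι_desc _ _

/-- The shift endomorphism of the coproduct of a sequence. -/
noncomputable def seqShift {X : ℕ → C} (x : ∀ n, X n ⟶ X (n + 1)) : seqSum X ⟶ seqSum X :=
  seqDesc fun n => x n ≫ seqι X (n + 1)

lemma seqι_seqShift {X : ℕ → C} (x : ∀ n, X n ⟶ X (n + 1)) (n : ℕ) :
    seqι X n ≫ seqShift x = x n ≫ seqι X (n + 1) :=
  seqι_seqDesc _ _

end Sequences

section Pretriangulated

variable {C : Type u} [Category.{v} C] [Preadditive C] [HasZeroObject C] [HasShift C ℤ]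
  [∀ n : ℤ, (shiftFunctor C n).Additive] [Pretriangulated C]

lemma IsCompactObj.shift {M : C} (hM : IsCompactObj M) (n : ℤ) : IsCompactObj (M⟦n⟧) := by
  intro J
  have := hM J
  let a (Y : C) : (M ⟶ Y⟦-n⟧) ≃+ (M⟦n⟧ ⟶ Y) :=
    { toEquiv := ((shiftEquiv C n).toAdjunction.homEquiv M Y).symm
      map_add' := fun f g => by
        have h (f : M ⟶ Y⟦-n⟧) : ((shiftEquiv C n).toAdjunction.homEquiv M Y).symm f =
          f⟦n⟧' ≫ (shiftEquiv C n).counit.app Y := Adjunction.homEquiv_counit _ _ _ _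
        refine (h _).trans (Eq.trans ?_ (congrArg₂ (· + ·) (h f) (h g)).symm)
        exact (congrArg (· ≫ _) (Functor.map_add _)).trans (Preadditive.add_comp _ _ _ _ _ _) }
  have ha {Y Z : C} (k : Y ⟶ Z) (f : M ⟶ Y⟦-n⟧) : a Z (f ≫ k⟦-n⟧') = a Y f ≫ k :=
    Adjunction.homEquiv_naturality_right_symm _ _ _
  have e : shiftFunctor C (-n) ⋙ preadditiveCoyoneda.obj (Opposite.op M) ≅
      preadditiveCoyoneda.obj (Opposite.op (M⟦n⟧)) :=
    NatIso.ofComponents (fun Y => (a Y).toAddCommGrpIso) fun k => by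
      ext f
      exact ha k f
  exact preservesColimitsOfShape_of_natIso e

variable [HasCoproducts.{v} C]

/-- A compact object maps trivially to the homotopy colimit of a sequence if each of its morphisms
to a term of the sequence becomes zero in the next one. -/
lemma IsCompactObj.eq_zero_of_hocolim {M : C} (hM : IsCompactObj M) {X : ℕ → C}
    (x : ∀ n, X n ⟶ X (n + 1)) (hx : ∀ n (f : M ⟶ X n), f ≫ x n = 0)
    {D : C} {p : seqSum X ⟶ D} {w : D ⟶ (seqSum X)⟦(1 : ℤ)⟧}
    (hT : Triangle.mk (𝟙 _ - seqShift x) p w ∈ distTriang C) (f : M ⟶ D) : f = 0 := by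
  have hf : f ≫ w = 0 := by
    let hc := isColimitCofanMkObjOfIsColimit (shiftFunctor C (1 : ℤ)) _ _
      (coproductIsCoproduct fun n : ULift.{v} ℕ => X n.down)
    refine hM.eq_zero_of_comp_shift_eq (fun n => (x n)⟦(1 : ℤ)⟧') hc
      ((seqShift x)⟦(1 : ℤ)⟧') (fun n => ?_) _ ?_
    · change (seqι X n)⟦(1 : ℤ)⟧' ≫ _ = _ ≫ (seqι X (n + 1))⟦(1 : ℤ)⟧'
      rw [← Functor.map_comp, ← Functor.map_comp, seqι_seqShift]
    · have h : w ≫ (𝟙 (seqSum X) - seqShift x)⟦(1 : ℤ)⟧' = 0 := comp_distTriang_mor_zero₃₁ _ hT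
      rw [Functor.map_sub, CategoryTheory.Functor.map_id, Preadditive.comp_sub, Category.comp_id,
        sub_eq_zero] at h
      exact (Category.assoc _ _ _).trans (congrArg (f ≫ ·) h.symm)
  obtain ⟨g, rfl⟩ := Triangle.coyoneda_exact₃ _ hT f hf
  -- In `D` the inclusion of `X n` factors through `x n`, which kills every morphism from `M`.
  have hp (n : ℕ) : seqι X n ≫ p = x n ≫ seqι X (n + 1) ≫ p := by
    have h : (𝟙 (seqSum X) - seqShift x) ≫ p = 0 := comp_distTriang_mor_zero₁₂ _ hT
    rw [Preadditive.sub_comp, Category.id_comp, sub_eq_zero] at h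
    conv_lhs => rw [h]
    rw [← Category.assoc, seqι_seqShift, Category.assoc]
  exact hM.mem_of_forall_inj (coproductIsCoproduct fun n : ULift.{v} ℕ => X n.down)
    ((Preadditive.rightComp M p).ker) (fun ⟨n⟩ k => by
      change (k ≫ seqι X n) ≫ p = 0
      rw [Category.assoc, hp, reassoc_of% hx n k, zero_comp]) g

/-- The homotopy colimit of a constant sequence. -/
lemma exists_hocolim_const (Y : C) :
    ∃ (p : seqSum (fun _ => Y) ⟶ Y) (w : Y ⟶ (seqSum fun _ => Y)⟦(1 : ℤ)⟧),
      Triangle.mk (𝟙 _ - seqShift (X := fun _ => Y) fun _ => 𝟙 Y) p w ∈ distTriang C := by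
  let X : ℕ → C := fun _ => Y
  let ι : ℕ → (Y ⟶ seqSum X) := seqι X
  let d : seqSum X ⟶ seqSum X := 𝟙 _ - seqShift (X := X) fun _ => 𝟙 Y
  have hd (n : ℕ) : ι n ≫ d = ι n - ι (n + 1) := by
    dsimp only [d, ι]
    rw [Preadditive.comp_sub, Category.comp_id, seqι_seqShift]
    exact congrArg _ (Category.id_comp _)
  let p : seqSum X ⟶ Y := seqDesc (X := X) fun _ => 𝟙 Y
  have hp (n : ℕ) : ι n ≫ p = 𝟙 Y := seqι_seqDesc _ n
  -- The retraction of `d` found by telescoping: `ι n = ι 0 - ∑_{k < n} (ι k - ι (k + 1))`. Thus `d`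
  -- is a split monomorphism with complement `Y`, embedded by `ι 0`.
  let r : seqSum X ⟶ seqSum X := seqDesc (X := X) fun n => -∑ k ∈ Finset.range n, ι k
  have hr (n : ℕ) : ι n ≫ r = -∑ k ∈ Finset.range n, ι k := seqι_seqDesc _ n
  have hdp : d ≫ p = 0 := seqSum_hom_ext fun n => by
    change ι n ≫ d ≫ p = ι n ≫ 0
    rw [reassoc_of% hd, Preadditive.sub_comp, hp, hp, sub_self, comp_zero]
  have hdr : d ≫ r = 𝟙 _ := seqSum_hom_ext fun n => by
    change ι n ≫ d ≫ r = ι n ≫ 𝟙 _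
    rw [reassoc_of% hd, Preadditive.sub_comp, hr, hr, Finset.sum_range_succ, Category.comp_id]
    abel
  have hrd : r ≫ d + p ≫ ι 0 = 𝟙 _ := seqSum_hom_ext fun n => by
    change ι n ≫ (r ≫ d + p ≫ ι 0) = ι n ≫ 𝟙 _
    rw [Preadditive.comp_add, reassoc_of% hr, reassoc_of% hp, Preadditive.neg_comp,
      Preadditive.sum_comp, Finset.sum_congr rfl fun k _ => hd k, Finset.sum_range_sub',
      Category.comp_id]
    abel
  let e : seqSum X ≅ seqSum X ⊞ Y :=
    { hom := biprod.lift r p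
      inv := biprod.desc d (ι 0)
      hom_inv_id := by rw [biprod.lift_desc, hrd]
      inv_hom_id := by
        apply biprod.hom_ext'
        · rw [biprod.inl_desc_assoc, Category.comp_id]
          apply biprod.hom_ext <;> simp [hdr, hdp]
        · rw [biprod.inr_desc_assoc, Category.comp_id]
          apply biprod.hom_ext <;> simp [hr, hp] }
  refine ⟨p, 0, distinguished_of_iso (binaryBiproductTriangle_distinguished (seqSum X) Y) e
    (Iso.refl _) ?_ ?_ ?_⟩
  · change d ≫ biprod.lift r p = biprod.inl
    apply biprod.hom_ext <;> simp [hdr, hdp]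
  · exact (Category.comp_id _).trans (biprod.lift_snd _ _).symm
  · exact comp_zero.symm

end Pretriangulated

/-! ### Orthogonality of classes of shifts -/

section Shifts

variable {C : Type u} [Category.{v} C] [Preadditive C] [HasZeroObject C] [HasShift C ℤ]
  [∀ n : ℤ, (shiftFunctor C n).Additive] [Pretriangulated C]

lemma shifts_monotone (P : Set C) {S S' : Set ℤ} (h : S ⊆ S') : shifts P S ≤ shifts P S' :=
  fun _ ⟨Y, hY, i, hi, e⟩ => ⟨Y, hY, i, h hi, e⟩

lemma shifts_singleton_shift (G : C) {S : Set ℤ} {i : ℤ} (hi : i ∈ S) :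
    shifts {G} S (G⟦i⟧) :=
  ⟨G, rfl, i, hi, ⟨Iso.refl _⟩⟩

lemma shifts_singleton_self (G : C) {S : Set ℤ} (h : 0 ∈ S) : shifts {G} S G :=
  ⟨G, rfl, 0, h, ⟨((shiftFunctorZero C ℤ).app G).symm⟩⟩

lemma shifts.isCompactObj {G : C} (hG : IsCompactObj G) {S : Set ℤ} {X : C}
    (hX : shifts {G} S X) : IsCompactObj X := by
  obtain ⟨_, rfl, i, -, ⟨e⟩⟩ := hX
  exact (hG.shift i).of_iso e.symm

/-- Shifting the closure of a class of shifts. -/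
lemma closure_shifts_shift {P : Set C} {S S' : Set ℤ} {n : ℤ} (h : ∀ i ∈ S, i + n ∈ S')
    {X : C} (hX : bigExtensionClosure (shifts P S) X) :
    bigExtensionClosure (shifts P S') (X⟦n⟧) := by
  refine ((isBigClosed_bigExtensionClosure _).inverseImage_shift n).closure_le ?_ X hX
  rintro X ⟨Y, hY, i, hi, ⟨e⟩⟩
  exact .of_mem ⟨Y, hY, i + n, h i hi,
    ⟨(shiftFunctor C n).mapIso e ≪≫ ((shiftFunctorAdd C i n).app Y).symm⟩⟩

lemma eq_zero_of_shift {G Y : C} {i j : ℤ} (h : ∀ f : G ⟶ Y⟦j - i⟧, f = 0)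
    (f : G⟦i⟧ ⟶ Y⟦j⟧) : f = 0 := by
  apply (shiftFunctor C (-i)).map_injective
  rw [Functor.map_zero]
  let e₁ : (G⟦i⟧)⟦-i⟧ ≅ G := (shiftShiftNeg G i)
  let e₂ : (Y⟦j⟧)⟦-i⟧ ≅ Y⟦j - i⟧ := ((shiftFunctorAdd' C j (-i) (j - i) (by omega)).app Y).symm
  have := h (e₁.inv ≫ f⟦-i⟧' ≫ e₂.hom)
  rw [← cancel_mono e₂.hom, ← cancel_epi e₁.inv, this]
  simp

/-- If `G` is orthogonal to `G[i]` for `i > d`, then classes generated by shifts of `G` are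
orthogonal as soon as the shifts differ by more than `d`. -/
lemma eq_zero_of_closure_shifts {G : C} (hG : IsCompactObj G) {d : ℤ}
    (hd : ∀ i, d < i → ∀ f : G ⟶ G⟦i⟧, f = 0) {S S' : Set ℤ}
    (hS : ∀ i ∈ S, ∀ j ∈ S', d < j - i) {X Y : C}
    (hX : bigExtensionClosure (shifts {G} S) X) (hY : bigExtensionClosure (shifts {G} S') Y)
    (f : X ⟶ Y) : f = 0 := by
  refine eq_zero_of_mem_closure (fun X hX => shifts.isCompactObj hG hX) ?_ hX hY f
  rintro X Y ⟨_, rfl, i, hi, ⟨e⟩⟩ ⟨_, rfl, j, hj, ⟨e'⟩⟩ f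
  have := eq_zero_of_shift (hd (j - i) (hS i hi j hj)) (e.inv ≫ f ≫ e'.hom)
  rw [← cancel_mono e'.hom, ← cancel_epi e.inv, this]
  simp

end Shifts

/-! ### Truncation triangles -/

section Truncation

variable {C : Type u} [Category.{v} C] [Preadditive C] [HasZeroObject C] [HasShift C ℤ]
  [∀ n : ℤ, (shiftFunctor C n).Additive] [Pretriangulated C] [IsTriangulated C]

open Triangulated

/-- By the octahedral axiom, the cone of the composite is an extension of the cone of `g` by the
cone of `f`. -/
lemma trW_comp {A : ObjectProperty C} (hA : IsBigClosed A) {X Y Z : C} {f : X ⟶ Y} {g : Y ⟶ Z}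
    (hf : A.trW f) (hg : A.trW g) : A.trW (f ≫ g) := by
  obtain ⟨U, _, _, hU, hAU⟩ := hf
  obtain ⟨V, _, _, hV, hAV⟩ := hg
  obtain ⟨W, _, _, hW⟩ := distinguished_cocone_triangle (f ≫ g)
  exact ⟨W, _, _, hW, hA.extension (someOctahedron rfl hU hV hW).mem hAU hAV⟩

variable [HasCoproducts.{v} C]

/-- If the morphisms of a sequence have cones in a class closed under extensions, coproducts and
`[1]`, then so does some morphism from its first term to its homotopy colimit. -/
lemma exists_trW_hocolim {A : ObjectProperty C} (hA : IsBigClosed A)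
    (hA' : ∀ X, A X → A (X⟦(1 : ℤ)⟧)) {X : ℕ → C} (x : ∀ n, X n ⟶ X (n + 1))
    (hx : ∀ n, A.trW (x n)) :
    ∃ (D : C) (p : seqSum X ⟶ D) (w : D ⟶ (seqSum X)⟦(1 : ℤ)⟧) (f : X 0 ⟶ D),
      Triangle.mk (𝟙 _ - seqShift x) p w ∈ distTriang C ∧ A.trW f := by
  obtain ⟨D, p, w, hD⟩ := distinguished_cocone_triangle (𝟙 _ - seqShift x)
  let c : ∀ n, X 0 ⟶ X n := fun n => Nat.rec (𝟙 _) (fun n f => f ≫ x n) n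
  have hc (n : ℕ) : A.trW (c n) := by
    induction n with
    | zero => exact ⟨_, _, _, contractible_distinguished _, hA.zero (isZero_zero C)⟩
    | succ n ih => exact trW_comp hA ih (hx n)
  choose Q q r hQ hAQ using hc
  -- Compare with the constant sequence, whose homotopy colimit is `X 0`.
  let K : ℕ → C := fun _ => X 0
  let a : seqSum K ⟶ seqSum X :=
    Limits.Sigma.map fun n : ULift.{v} ℕ => (c n.down : K n.down ⟶ X n.down)
  have ha (n : ℕ) : seqι K n ≫ a = c n ≫ seqι X n :=
    Sigma.ι_map (fun n : ULift.{v} ℕ => (c n.down : K n.down ⟶ X n.down)) ⟨n⟩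
  obtain ⟨t, ht⟩ := exists_sigma_distinguished fun n : ULift.{v} ℕ => hQ n.down
  have hAK : A (∐ fun n : ULift.{v} ℕ => Q n.down) :=
    hA.coproduct (coproductIsCoproduct _) fun n => hAQ n.down
  obtain ⟨p', w', hK⟩ := exists_hocolim_const (X 0)
  have comm : (𝟙 (seqSum K) - seqShift (X := K) fun _ => 𝟙 (X 0)) ≫ a =
      a ≫ (𝟙 (seqSum X) - seqShift x) := seqSum_hom_ext fun n => by
    have e : seqι K n ≫ seqShift (X := K) (fun _ => 𝟙 (X 0)) = seqι K (n + 1) :=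
      (seqι_seqShift _ n).trans (Category.id_comp _)
    rw [Preadditive.sub_comp, Preadditive.comp_sub, Preadditive.comp_sub, Preadditive.comp_sub,
      Category.id_comp, Category.comp_id, reassoc_of% e, reassoc_of% ha, ha, ha, seqι_seqShift]
    exact congrArg _ (Category.assoc _ _ _)
  obtain ⟨W, v, z, hW⟩ :=
    distinguished_cocone_triangle ((𝟙 (seqSum K) - seqShift (X := K) fun _ => 𝟙 (X 0)) ≫ a)
  -- Factoring one composite in two ways gives `X 0 ⟶ W` with cone `∐ Q` and `W ⟶ D` with cone `(∐
  -- Q)[1]`.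
  let o₁ := someOctahedron rfl hK ht hW
  let o₂ := someOctahedron comm.symm ht hD hW
  refine ⟨D, p, w, o₁.m₁ ≫ o₂.m₃, hD, trW_comp hA ⟨_, _, _, o₁.mem, hAK⟩
    ⟨_, _, _, rot_of_distTriang _ o₂.mem, hA' _ hAK⟩⟩

/-- Truncation with respect to the class generated by the `G[i]`, `i ∈ S`. -/
theorem exists_truncation {G : C} (hG : IsCompactObj G) {S : Set ℤ} (hS : ∀ i ∈ S, i + 1 ∈ S)
    (Y : C) :
    ∃ (E D : C) (f : E ⟶ Y) (g : Y ⟶ D) (h : D ⟶ E⟦(1 : ℤ)⟧),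
      Triangle.mk f g h ∈ distTriang C ∧ bigExtensionClosure (shifts {G} S) E ∧
        ∀ i ∈ S, ∀ k : G⟦i⟧ ⟶ D, k = 0 := by
  let U := bigExtensionClosure (shifts {G} S)
  have hU : IsBigClosed U := isBigClosed_bigExtensionClosure _
  -- This is `U[1]`: a morphism with cone in `A` has its fibre in `U`.
  let A : ObjectProperty C := fun X => U (X⟦(-1 : ℤ)⟧)
  have hA : IsBigClosed A := hU.inverseImage_shift (-1)
  have hUA (X : C) (hX : U X) : A (X⟦(1 : ℤ)⟧) :=
    hU.of_iso (shiftShiftNeg X (1 : ℤ)).symm hX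
  have hA' (X : C) (hX : A X) : A (X⟦(1 : ℤ)⟧) := by
    refine hUA _ (hU.of_iso (shiftNegShift X (1 : ℤ)) (closure_shifts_shift hS hX))
  -- `Y'` is the cone of the evaluation map from the coproduct of all `G⟦i⟧`, `i ∈ S`, indexed by
  -- their morphisms to `Y`.
  have step (Y : C) : ∃ (Y' : C) (x : Y ⟶ Y'), A.trW x ∧
      ∀ i ∈ S, ∀ k : G⟦i⟧ ⟶ Y, k ≫ x = 0 := by
    let K : (Σ i : S, (G⟦(i : ℤ)⟧ ⟶ Y)) → C := fun j => G⟦(j.1 : ℤ)⟧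
    obtain ⟨Y', x, w, hT⟩ := distinguished_cocone_triangle (Sigma.desc fun j => j.2 : ∐ K ⟶ Y)
    refine ⟨Y', x, ⟨_, _, _, rot_of_distTriang _ hT, hUA _ (hU.coproduct
      (coproductIsCoproduct K) fun j => .of_mem (shifts_singleton_shift G j.1.2))⟩,
      fun i hi k => ?_⟩
    have e : Sigma.ι K ⟨⟨i, hi⟩, k⟩ ≫ (Sigma.desc fun j => j.2 : ∐ K ⟶ Y) = k := Sigma.ι_desc _ _
    rw [← e, Category.assoc, comp_zero_of_distinguished₁₂ hT, comp_zero]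
  choose next x hxA hx using step
  let X : ℕ → C := fun n => Nat.rec Y (fun _ Z => next Z) n
  obtain ⟨D, p, w, f, hD, V, g, h, hT, hV⟩ :=
    exists_trW_hocolim hA hA' (X := X) (fun n => x (X n)) fun n => hxA (X n)
  exact ⟨_, D, _, f, _, inv_rot_of_distTriang _ hT, hV, fun i hi k =>
    (hG.shift i).eq_zero_of_hocolim (X := X) (fun n => x (X n)) (fun n => hx (X n) i hi) hD k⟩

end Truncation

/-! ### The t-structure generated by `G` -/

section TStructures

variable {C : Type u} [Category.{v} C] [Preadditive C] [HasZeroObject C] [HasShift C ℤ]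
  [∀ n : ℤ, (shiftFunctor C n).Additive] [Pretriangulated C]

lemma eq_zero_of_unshift {G Y : C} {i j : ℤ} (h : ∀ f : G⟦i - j⟧ ⟶ Y, f = 0)
    (f : G⟦i⟧ ⟶ Y⟦j⟧) : f = 0 := by
  apply (shiftFunctor C (-j)).map_injective
  rw [Functor.map_zero]
  let e₁ : (G⟦i⟧)⟦-j⟧ ≅ G⟦i - j⟧ := ((shiftFunctorAdd' C i (-j) (i - j) (by omega)).app G).symm
  let e₂ : (Y⟦j⟧)⟦-j⟧ ≅ Y := shiftShiftNeg Y j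
  have := h (e₁.inv ≫ f⟦-j⟧' ≫ e₂.hom)
  rw [← cancel_mono e₂.hom, ← cancel_epi e₁.inv, this]
  simp

variable [IsTriangulated C] [HasCoproducts.{v} C]

/-- The `t`-structure generated by a compact object. -/
def generatedTStructure {G : C} (hG : IsCompactObj G) : Triangulated.TStructure C where
  le n := bigExtensionClosure (shifts {G} (Set.Ici (-n)))
  -- The bound `1 - n ≤ i` expresses orthogonality to the generators of `C^{≤ n - 1}`.
  ge n := fun Y => ∀ i : ℤ, 1 - n ≤ i → ∀ k : G⟦i⟧ ⟶ Y, k = 0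
  le_isClosedUnderIsomorphisms n := ⟨(isBigClosed_bigExtensionClosure _).of_iso⟩
  ge_isClosedUnderIsomorphisms n := ⟨fun e hX i hi k => by
    rw [← cancel_mono e.inv, zero_comp]
    exact hX i hi _⟩
  le_shift n a n' h X hX := closure_shifts_shift (fun i hi => by
    simp only [Set.mem_Ici] at hi ⊢
    omega) hX
  ge_shift n a n' h X hX i hi := eq_zero_of_unshift (hX _ (by omega))
  zero' X Y f hX hY := (isBigClosed_leftOrthogonal Y).closure_le (by
    rintro Z ⟨_, rfl, i, hi, ⟨e⟩⟩ k
    rw [← cancel_epi e.inv, comp_zero]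
    exact hY i (by simpa using hi) _) X hX f
  le_zero_le := bigExtensionClosure_monotone (shifts_monotone _ (Set.Ici_subset_Ici.2 (by omega)))
  ge_one_le _ hX i hi := hX i (by omega)
  exists_triangle_zero_one Y := by
    obtain ⟨E, D, f, g, h, hT, hE, hD⟩ :=
      exists_truncation hG (S := Set.Ici (-0)) (fun i hi => by
        simp only [Set.mem_Ici] at hi ⊢
        omega) Y
    exact ⟨E, D, hE, fun i hi => hD i (by simpa using hi), f, g, h, hT⟩

/-- Morphisms `G[-A] ⟶ G[j]` with `j ≥ 0` amount to morphisms `G ⟶ G[j + A]`, and `j + A > 1` once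
`A ≥ 2`. -/
lemma boundedFor_generatedTStructure {G : C} (hG : IsCompactObj G)
    (h : ∀ i : ℤ, 1 < i → ∀ f : G ⟶ G⟦i⟧, f = 0) {A : ℕ} (hA : 2 ≤ A) :
    BoundedFor G (generatedTStructure hG) A := by
  refine ⟨.of_mem (shifts_singleton_shift G (by simp)), fun Y hY => ?_⟩
  refine eq_zero_of_closure_shifts hG h (S := {-(A : ℤ)}) (S' := Set.Ici (-0)) ?_
    (.of_mem (shifts_singleton_shift G rfl)) hY
  rintro _ rfl j hj
  simp only [Set.mem_Ici] at hj
  omega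

/-- Weak negativity is exactly `K ⊥ B[1]` on generators, so `K ⋆ B` is closed; it contains `G`
through `K` and the `G[i]`, `i ≥ 1`, through `B`. -/
lemma approximatesBy_generatedTStructure {G : C} (hG : IsCompactObj G)
    (h : ∀ i : ℤ, 1 < i → ∀ f : G ⟶ G⟦i⟧, f = 0) :
    ApproximatesBy (generatedTStructure hG) (bigExtensionClosure (shifts {G} {0})) := by
  let K := bigExtensionClosure (shifts {G} {0})
  let B := bigExtensionClosure (shifts {G} (Set.Ici (- -1)))
  have hK : IsBigClosed K := isBigClosed_bigExtensionClosure _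
  have hB : IsBigClosed B := isBigClosed_bigExtensionClosure _
  have : K.ContainsZero := ⟨⟨_, isZero_zero C, hK.zero (isZero_zero C)⟩⟩
  have : B.ContainsZero := ⟨⟨_, isZero_zero C, hB.zero (isZero_zero C)⟩⟩
  have hKB : IsBigClosed (ObjectProperty.extensionProduct K B) := by
    refine hK.extensionProduct hB fun X Y hX hY => ?_
    refine eq_zero_of_closure_shifts hG h (S := {0}) (S' := Set.Ici 2) ?_ hX
      (closure_shifts_shift ?_ hY)
    · rintro _ rfl j hj
      simp only [Set.mem_Ici] at hj
      omega
    · intro i hi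
      simp only [Set.mem_Ici] at hi ⊢
      omega
  intro F hF
  refine hKB.closure_le ?_ F hF
  rintro X ⟨Y, hY, i, hi, e⟩
  simp only [Set.mem_Ici] at hi
  obtain rfl | hi' := eq_or_ne i 0
  · exact ObjectProperty.le_extensionProduct_left B _ (.of_mem ⟨Y, hY, 0, rfl, e⟩)
  · exact ObjectProperty.le_extensionProduct_right K _
      (.of_mem ⟨Y, hY, i, by simp only [Set.mem_Ici]; omega, e⟩)

lemma ApproximatesBy.mono {t : Triangulated.TStructure C} {E E' : ObjectProperty C}
    (h : ApproximatesBy t E) (hE : E ≤ E') : ApproximatesBy t E' := fun F hF => by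
  obtain ⟨X, D, f, g, w, hT, hX, hD⟩ := h F hF
  exact ⟨X, D, f, g, w, hT, hE X hX, hD⟩

end TStructures

/-! ### Reduction to a single generator -/

section Generators

variable {C : Type u} [Category.{v} C] [Preadditive C] [HasZeroObject C] [HasShift C ℤ]
  [∀ n : ℤ, (shiftFunctor C n).Additive] [Pretriangulated C]

/-- The direct sum of a finite set of objects. -/
lemma exists_directSum {P : Set C} (hP : P.Finite) :
    ∃ G : C, (∀ M ∈ P, Nonempty (Retract M G)) ∧
      ∀ L : ObjectProperty C, (∀ X, IsZero X → L X) → (∀ X Y, L X → L Y → L (X ⊞ Y)) →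
        (∀ M ∈ P, L M) → L G := by
  induction P, hP using Set.Finite.induction_on with
  | empty =>
    obtain ⟨Z, hZ⟩ := HasZeroObject.zero (C := C)
    exact ⟨Z, by simp, fun L h₀ _ _ => h₀ Z hZ⟩
  | @insert M P _ _ ih =>
    obtain ⟨G, hG, hG'⟩ := ih
    refine ⟨M ⊞ G, ?_, fun L h₀ h₁ h₂ => h₁ _ _ (h₂ M (Set.mem_insert _ _))
      (hG' L h₀ h₁ fun N hN => h₂ N (Set.mem_insert_of_mem _ hN))⟩
    rintro N (rfl | hN)
    · exact ⟨⟨biprod.inl, biprod.fst, biprod.inl_fst⟩⟩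
    · exact (hG N hN).map fun r => r.trans ⟨biprod.inr, biprod.snd, biprod.inr_snd⟩

variable [IsTriangulated C] [HasCoproducts.{v} C]

/-- A finite weakly negative compactly generating set can be replaced by the direct sum of its
elements. -/
lemma exists_compact_generator {P : Set C} (hP : P.Finite) (hneg : IsWeaklyNegative P)
    (hgen : CompactlyGenerates P) :
    ∃ G : C, CompactlyGenerates {G} ∧ (∀ i : ℤ, 1 < i → ∀ f : G ⟶ G⟦i⟧, f = 0) ∧
      (∀ M ∈ P, Nonempty (Retract M G)) ∧
      ∀ L : ObjectProperty C, IsBigClosed L → (∀ M ∈ P, L M) → L G := by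
  obtain ⟨G, hr, hL⟩ := exists_directSum hP
  have hL' (L : ObjectProperty C) (h : IsBigClosed L) : (∀ M ∈ P, L M) → L G :=
    hL L (fun _ => h.zero) fun _ _ => h.biprod
  have hG : IsCompactObj G := hL _ (fun _ => .of_isZero) (fun _ _ => .biprod) hgen.1
  refine ⟨G, ⟨by rintro _ rfl; exact hG, fun X => ?_⟩, fun i hi => ?_, hr, hL'⟩
  -- Truncate with respect to all shifts of `G`. Then `D` receives no nonzero morphism from a shift
  -- of `G`, nor of its retracts in `P`, which generate; so `𝟙 D = 0`.
  · obtain ⟨E, D, f, g, h, hT, hE, hD⟩ := exists_truncation hG (S := Set.univ) (by simp) X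
    have hD' : ∀ f : D ⟶ D, f = 0 := by
      refine (isBigClosed_leftOrthogonal D).closure_le ?_ D (hgen.2 D)
      rintro Z ⟨M, hM, i, -, ⟨e⟩⟩ k
      obtain ⟨r⟩ := hr M hM
      have h₁ := hD i trivial (r.r⟦i⟧' ≫ e.inv ≫ k)
      rw [← cancel_epi e.inv, comp_zero, ← Category.id_comp (e.inv ≫ k),
        ← CategoryTheory.Functor.map_id, ← r.retract, Functor.map_comp, Category.assoc, h₁,
        comp_zero]
    exact .extension hT hE (.zero ((IsZero.iff_id_eq_zero D).2 (hD' _)))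
  · refine hL' _ (isBigClosed_leftOrthogonal _) fun M hM => ?_
    exact hL' _ ((isBigClosed_rightOrthogonal (hgen.1 M hM)).inverseImage_shift i) fun N hN =>
      hneg i hi M hM N hN

theorem isWeaklyApproximable_of_finite {P : Set C} (hP : P.Finite) (hneg : IsWeaklyNegative P)
    (hgen : CompactlyGenerates P) : IsWeaklyApproximable C := by
  obtain ⟨G, hG, hneg', -, -⟩ := exists_compact_generator hP hneg hgen
  refine ⟨G, generatedTStructure (hG.1 G rfl), 2, by omega, hG,
    boundedFor_generatedTStructure _ hneg' le_rfl,
    (approximatesBy_generatedTStructure _ hneg').mono ?_⟩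
  exact (bigExtensionClosure_monotone (shifts_monotone _ (by simp))).trans
    (ObjectProperty.le_retractClosure _)

end Generators

/-! ### Filtrations and approximability -/

section Filtrations

variable {C : Type u} [Category.{v} C] [Preadditive C] [HasZeroObject C] [HasShift C ℤ]
  [∀ n : ℤ, (shiftFunctor C n).Additive] [Pretriangulated C]

open ObjectProperty

lemma IsBigClosed.coproductsOf_le {P L : ObjectProperty C} (hL : IsBigClosed L) (h : P ≤ L) :
    coproductsOf P ≤ L := by
  intro X hX
  obtain ⟨J, Y, c, hc, rfl, hY⟩ := hX.exists_cofan
  exact hL.coproduct hc fun j => h _ (hY j)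

/-- Coproducts of retracts are retracts of coproducts. -/
lemma coproductsOf_le_retractClosure [HasCoproducts.{v} C] {P L : ObjectProperty C}
    (h : ∀ M, P M → ∃ G, L G ∧ Nonempty (Retract M G)) :
    coproductsOf P ≤ (coproductsOf L).retractClosure := by
  intro X hX
  obtain ⟨J, Y, c, hc, rfl, hY⟩ := hX.exists_cofan
  choose G hG r using fun j => h _ (hY j)
  refine ⟨∐ G, .of_cofan (coproductIsCoproduct G) hG,
    ⟨⟨Cofan.IsColimit.desc hc fun j => (r j).some.i ≫ Sigma.ι G j,
      Sigma.desc fun j => (r j).some.r ≫ c.inj j, ?_⟩⟩⟩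
  refine Cofan.IsColimit.hom_ext hc _ _ fun j => ?_
  rw [← Category.assoc, Cofan.IsColimit.fac hc, Category.assoc, Sigma.ι_desc,
    (r j).some.retract_assoc]
  exact (Category.comp_id _).symm

/-- If `P ⊥ P[1]`, the class of coproducts of elements of `P` is closed under extensions. -/
lemma isBigClosed_coproductsOf {P : Set C} (hP : ∀ M ∈ P, IsCompactObj M)
    (h : PerpShift P P 1) : IsBigClosed (coproductsOf (· ∈ P)) where
  zero := .of_isZero _
  extension {T} hT h₁ h₃ := by
    have hw : T.mor₃ = 0 := by
      refine (isBigClosed_leftOrthogonal _).coproductsOf_le (fun M hM => ?_) _ h₃ T.mor₃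
      exact ((isBigClosed_rightOrthogonal (hP M hM)).inverseImage_shift 1).coproductsOf_le
        (fun N hN => h M hM N hN) _ h₁
    obtain ⟨e, -, -⟩ := exists_iso_binaryBiproduct_of_distTriang _ hT hw
    exact (h₁.biprod h₃).of_iso e.symm
  coproduct := .coproduct

/-- The class of objects with a filtration whose factors are coproducts of elements of
`Q 0, …, Q k`. -/
def filtered (Q : ℕ → Set C) : ℕ → ObjectProperty C
  | 0 => coproductsOf (· ∈ Q 0)
  | k + 1 => extensionProduct (filtered Q k) (coproductsOf (· ∈ Q (k + 1)))

lemma IsBigClosed.filtered_le {L : ObjectProperty C} (hL : IsBigClosed L) {Q : ℕ → Set C} {k : ℕ}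
    (h : ∀ i ≤ k, ∀ M ∈ Q i, L M) : filtered Q k ≤ L := by
  induction k with
  | zero => exact hL.coproductsOf_le (h 0 le_rfl)
  | succ k ih =>
    rintro X ⟨Y, Z, f, g, w, hT, hY, hZ⟩
    exact hL.extension hT (ih (fun i hi => h i (by omega)) Y hY)
      (hL.coproductsOf_le (h (k + 1) le_rfl) Z hZ)

variable [IsTriangulated C] [HasCoproducts.{v} C]

/-- Orthogonality for all `i ≤ k + 1` makes the first `k + 1` layers orthogonal to the shift of the
next one, as the reordering principle requires. -/
lemma isBigClosed_filtered {Q : ℕ → Set C} (hQ : ∀ i, ∀ M ∈ Q i, IsCompactObj M)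
    (h : ∀ i j, i ≤ j → PerpShift (Q i) (Q j) 1) (k : ℕ) : IsBigClosed (filtered Q k) := by
  induction k with
  | zero => exact isBigClosed_coproductsOf (hQ 0) (h 0 0 le_rfl)
  | succ k ih =>
    refine ih.extensionProduct (isBigClosed_coproductsOf (hQ _) (h _ _ le_rfl))
      fun X Y hX hY => ?_
    refine (isBigClosed_leftOrthogonal _).filtered_le (fun i hi M hM => ?_) X hX
    exact ((isBigClosed_rightOrthogonal (hQ i M hM)).inverseImage_shift 1).coproductsOf_le
      (fun N hN => h i (k + 1) (by omega) M hM N hN) Y hY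

lemma mem_filtered {Q : ℕ → Set C} (hQ : ∀ i, ∀ M ∈ Q i, IsCompactObj M)
    (h : ∀ i j, i ≤ j → PerpShift (Q i) (Q j) 1) {i k : ℕ} (hi : i ≤ k) {M : C} (hM : M ∈ Q i) :
    filtered Q k M := by
  induction k with
  | zero =>
    obtain rfl : i = 0 := by omega
    exact le_coproductsOf _ _ hM
  | succ k ih =>
    have hzero {L : ObjectProperty C} (hL : IsBigClosed L) : L.ContainsZero :=
      ⟨⟨_, isZero_zero C, hL.zero (isZero_zero C)⟩⟩
    have := hzero (isBigClosed_filtered hQ h k)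
    have := hzero (isBigClosed_coproductsOf (hQ (k + 1)) (h _ _ le_rfl))
    obtain rfl | hi' := eq_or_ne i (k + 1)
    · exact le_extensionProduct_right (filtered Q k) _ (le_coproductsOf _ _ hM)
    · exact le_extensionProduct_left (coproductsOf (· ∈ Q (k + 1))) _ (ih (by omega))

/-- Trades the elements of the `Q i` for objects of `L`, layer by layer; retracts can be moved
outside `⋆`. -/
lemma filtered_le_retractClosure {Q : ℕ → Set C} {L : ObjectProperty C}
    (h : ∀ i, ∀ M ∈ Q i, ∃ G, L G ∧ Nonempty (Retract M G)) (k : ℕ) :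
    filtered Q k ≤ ((coproductsOf L).extensionProductIter k).retractClosure := by
  induction k with
  | zero => exact coproductsOf_le_retractClosure (h 0)
  | succ k ih =>
    rw [extensionProductIter_succ']
    exact ((monotone_extensionProduct_left _ ih).trans (monotone_extensionProduct_right _
      (coproductsOf_le_retractClosure (h (k + 1))))).trans
        (extensionProduct_retractClosure_retractClosure_le _ _)

theorem isApproximable_of_finite {P : Set C} (hP : P.Finite) (hneg : IsWeaklyNegative P)
    (hgen : CompactlyGenerates P) (n : ℕ) (Q : ℕ → Set C) (hQP : ∀ i, Q i ⊆ P)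
    (hPQ : ∀ M ∈ P, ∃ i ≤ n, M ∈ Q i) (hQ : ∀ i j, i ≤ j → PerpShift (Q i) (Q j) 1) :
    IsApproximable C := by
  obtain ⟨G, hG, hneg', hr, hL⟩ := exists_compact_generator hP hneg hgen
  -- `n + 2` is at least `2`, as boundedness requires, and exceeds the number `n + 1` of layers.
  refine ⟨G, generatedTStructure (hG.1 G rfl), n + 2, by omega, hG,
    boundedFor_generatedTStructure _ hneg' (by omega),
    (approximatesBy_generatedTStructure _ hneg').mono ?_⟩
  have hQc (i : ℕ) (M : C) (hM : M ∈ Q i) : IsCompactObj M := hgen.1 M (hQP i hM)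
  have hF := isBigClosed_filtered hQc hQ n
  let L := shifts {G} (Set.Icc (-((n + 2 : ℕ) : ℤ)) ((n + 2 : ℕ) : ℤ))
  have hLG : L G := shifts_singleton_self G ⟨by omega, by omega⟩
  have : (coproductsOf L).ContainsZero := ⟨⟨_, isZero_zero C, .of_isZero _ (isZero_zero C)⟩⟩
  have h₁ : bigExtensionClosure (shifts {G} {0}) ≤ filtered Q n := by
    refine hF.closure_le ?_
    rintro X ⟨_, rfl, _, rfl, ⟨e⟩⟩
    refine hF.of_iso (e ≪≫ (shiftFunctorZero C ℤ).app _).symm (hL _ hF fun M hM => ?_)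
    obtain ⟨i, hi, hM'⟩ := hPQ M hM
    exact mem_filtered hQc hQ hi hM'
  exact (h₁.trans (filtered_le_retractClosure
    (fun i M hM => ⟨G, hLG, hr M (hQP i hM)⟩) n)).trans
      -- The `n + 1` factors are padded by a zero factor to `n + 2`.
      (monotone_retractClosure (monotone'_extensionProductIter _ (Nat.le_succ n)))

end Filtrations

end SmashingTriangulated

theorem corollary4p3 {C : Type u} [Category.{v} C] [Preadditive C] [HasZeroObject C]
    [HasShift C ℤ] [∀ n : ℤ, (shiftFunctor C n).Additive] [Pretriangulated C]
    [IsTriangulated C] [HasCoproducts.{v} C] :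
    (∀ P : Set C, P.Finite → SmashingTriangulated.IsWeaklyNegative P →
      SmashingTriangulated.CompactlyGenerates P →
        SmashingTriangulated.IsWeaklyApproximable C ∧
        ∀ (n : ℕ) (Q : Fin (n + 1) → Set C), P = ⋃ i, Q i →
          (∀ i j, i ≤ j → SmashingTriangulated.PerpShift (Q i) (Q j) 1) →
          SmashingTriangulated.IsApproximable C) ∧
    (∀ G : C, SmashingTriangulated.CompactlyGenerates {G} →
      (∀ i : ℤ, 0 < i → SmashingTriangulated.PerpShift {G} {G} i) →
      SmashingTriangulated.IsApproximable C) := by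
  refine ⟨fun P hP hneg hgen =>
    ⟨SmashingTriangulated.isWeaklyApproximable_of_finite hP hneg hgen, fun n Q hPQ hQ => ?_⟩,
    fun G hG h => ?_⟩
  -- Extended by the empty set beyond `n`, where orthogonality is vacuous.
  · let Q' : ℕ → Set C := fun i => {M | ∃ hi : i < n + 1, M ∈ Q ⟨i, hi⟩}
    refine SmashingTriangulated.isApproximable_of_finite hP hneg hgen n Q' ?_ ?_ ?_
    · rintro i M ⟨hi, hM⟩
      exact hPQ ▸ Set.mem_iUnion_of_mem _ hM
    · intro M hM
      rw [hPQ] at hM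
      obtain ⟨i, hi⟩ := Set.mem_iUnion.1 hM
      exact ⟨i, by omega, i.2, hi⟩
    · rintro i j hij X ⟨hi, hX⟩ Y ⟨hj, hY⟩
      exact hQ ⟨i, hi⟩ ⟨j, hj⟩ hij X hX Y hY
  -- The case `n = 0`: a single layer, namely `{G}`.
  · exact SmashingTriangulated.isApproximable_of_finite (Set.finite_singleton G)
      (fun i hi => h i (by omega)) hG 0 (fun _ => {G}) (fun _ => le_rfl)
      (fun M hM => ⟨0, le_rfl, hM⟩) fun _ _ _ => h 1 one_pos
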